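/- Let $\mathbb{Z}_+=\{0,1,2,\dots\}$ and let $g:\mathbb{Z}_+\to[0,\infty)$ satisfy $g(0)>0$. Assume that there exist $\alpha\in\mathbb{R}$ and $c_\alpha\in(0,\infty)$ with $\lim_{k\to\infty} g(k)/k^{\alpha}=c_\alpha$ or, alternatively, that $\sum_{j\ge 0} g(j)<\infty$. Put $G(k)=\sum_{j=0}^{k} g(j)$ and $Q_0(s)=\sum_{k\ge 0}s^kG(k)$, and for $s\in[0,1)$ let $\nu_s$ be the probability distribution on $\mathbb{Z}_+$ given by $\nu_s(k)=s^kG(k)/Q_0(s)$. For $K>0$ let $s^*(K)\in(0,1)$ denote the unique parameter for which $\nu_{s^*(K)}$ has mean $K$. Let $\{b_N\}_{N\ge 1}$ be a sequence of positive numbers with $\lim_{N\to\infty}b_N=\infty$, and set $s_N^*=s^*(b_N)$. For each $N\ge 1$ put $\Lambda_N=\{1,\dots,N\}$ and let $\{X_j^{(N)}\}_{j\in\Lambda_N}$ be independent and identically distributed $\mathbb{Z}_+$-valued random variables with common distribution $\nu_{s_N^*}$; let $\sigma_N^2=\mathrm{Var}(X_1^{(N)})$. Then, for every finite set $B\subset\mathbb{Z}_+$,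 $$\lim_{N\to\infty}\ \sup_{L\ge 0}\ \left|\sqrt{\sigma_N^2\,(N-|B|)}\; P\Bigl(\sum_{j\in\Lambda_N\setminus B}X_j^{(N)}=L\Bigr)-\frac{1}{\sqrt{2\pi}}\exp\Bigl\{-\frac{(L-(N-|B|)b_N)^2}{2\sigma_N^2\,(N-|B|)}\Bigr\}\right|=0,$$ where the supremum is over integers $L\ge 0$ and the expression is considered for $N>|B|$. -/

import Mathlib

open MeasureTheory ProbabilityTheory Filter Topology

noncomputable section

namespace MoneyExchange

/-- The partial sums `G(k) = g(0) + ... + g(k)` of the weight function `g`. -/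
def G (g : ℕ → ℝ) (k : ℕ) : ℝ := ∑ j ∈ Finset.range (k + 1), g j

/-- The power series `Q_n(s) = ∑_{k ≥ 0} k^n s^k G(k)`. -/
def Q (g : ℕ → ℝ) (n : ℕ) (s : ℝ) : ℝ := ∑' k : ℕ, (k : ℝ) ^ n * s ^ k * G g k

/-- The exponential family `ν_s` on the nonnegative integers: `ν_s({k}) = s^k G(k) / Q_0(s)`. -/
def nu (g : ℕ → ℝ) (s : ℝ) : Measure ℕ :=
  Measure.sum fun k : ℕ => ENNReal.ofReal (s ^ k * G g k / Q g 0 s) • Measure.dirac k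

/-- `s*(K)`: the parameter `s ∈ (0, 1)` for which `ν_s` has mean `K`. -/
def sStar (g : ℕ → ℝ) (K : ℝ) : ℝ :=
  Classical.epsilon fun s : ℝ => s ∈ Set.Ioo (0 : ℝ) 1 ∧ ∫ k, (k : ℝ) ∂(nu g s) = K

end MoneyExchange

end

/-! The law changes with `N`, so a local limit theorem is needed that is uniform over `ν_s`, `1/2 ≤
s < 1`. The natural scale of `ν_s` is `1/(1-s)`, and two properties of `G` control everything on
that scale.

Doubling, `G(2m+1) ≤ D G(m)`, is the only trace left of the hypotheses on `g`; it bounds the `n`-th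
moment of `ν_s` by a constant times `(1-s)^{-n}` (`Q_le`). Monotonicity of `G` bounds the
characteristic function on the whole period: by Abel summation `|φ_s(t)| ≤ (1-s)/|1 - s e^{it}|`
(`norm_tsum_pow_mul_G_le`, `sq_norm_charFun_nu_le`). At `t = 1-s` this keeps `|φ_s|` away from `1`,
which forces mean and standard deviation to be at least of order `1/(1-s)`. Hence mean, standard
deviation and cube root of the third moment are uniformly comparable, and `|φ_s(t)|^2 ≤ 1/(1 + c σ^2
t^2)` for `|t| ≤ π`: this is `IsRegular`.

For regular laws, Fourier inversion bounds the error at every `L` by one integral independent of `L`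
(`abs_sub_gaussian_le`). Its integrand tends to `0` pointwise by the third-order Taylor estimate and
is dominated by `(1 + c u^2/4)⁻¹` plus a Gaussian, so dominated convergence finishes. -/

namespace MoneyExchange

/-! ### Doubling of `G` and estimates for its generating functions -/

section Series

variable {g : ℕ → ℝ}

lemma G_succ (g : ℕ → ℝ) (k : ℕ) : G g (k + 1) = G g k + g (k + 1) := by
  simp [G, Finset.sum_range_succ]

lemma G_mono (hg : ∀ k, 0 ≤ g k) : Monotone (G g) :=
  monotone_nat_of_le_succ fun k => by rw [G_succ]; linarith [hg (k + 1)]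

lemma G_zero (g : ℕ → ℝ) : G g 0 = g 0 := by simp [G]

lemma G_pos (hg : ∀ k, 0 ≤ g k) (h0 : 0 < g 0) (k : ℕ) : 0 < G g k :=
  (G_zero g ▸ h0).trans_le (G_mono hg (Nat.zero_le k))

/-- Along an affine subsequence of ratio two, a function asymptotic to a power is eventually
bounded by a constant multiple of itself. -/
lemma eventually_le_mul_of_tendsto_div_rpow {α c : ℝ} (hc : 0 < c)
    (h : Tendsto (fun k : ℕ => g k / (k : ℝ) ^ α) atTop (𝓝 c)) (i : ℕ) :
    ∃ D : ℝ, 0 < D ∧ ∀ᶠ k : ℕ in atTop, g (2 * k + i) ≤ D * g k := by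
  have hu : ∀ᶠ k : ℕ in atTop, g k / (k : ℝ) ^ α < 2 * c := h.eventually_lt_const (by linarith)
  have hl : ∀ᶠ k : ℕ in atTop, c / 2 < g k / (k : ℝ) ^ α := h.eventually_const_lt (by linarith)
  have ht : Tendsto (fun k : ℕ => 2 * k + i) atTop atTop :=
    tendsto_atTop_mono (fun k => by simp only [id]; omega) tendsto_id
  have hr : Tendsto (fun k : ℕ => (((2 * k + i : ℕ) : ℝ) / (k : ℝ)) ^ α) atTop (𝓝 (2 ^ α)) := by
    have h1 : Tendsto (fun k : ℕ => ((2 * k + i : ℕ) : ℝ) / (k : ℝ)) atTop (𝓝 2) := by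
      have h2 : Tendsto (fun k : ℕ => (2 : ℝ) + (i : ℝ) / (k : ℝ)) atTop (𝓝 (2 + 0)) :=
        tendsto_const_nhds.add (tendsto_const_div_atTop_nhds_zero_nat _)
      rw [add_zero] at h2
      refine h2.congr' ?_
      filter_upwards [eventually_gt_atTop 0] with k hk
      have : (k : ℝ) ≠ 0 := by positivity
      push_cast
      field_simp
    exact h1.rpow_const (Or.inl two_ne_zero)
  have hp : (0 : ℝ) < 2 ^ α := by positivity
  have hr' : ∀ᶠ k : ℕ in atTop, (((2 * k + i : ℕ) : ℝ) / (k : ℝ)) ^ α < 2 * 2 ^ α :=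
    hr.eventually_lt_const (by linarith)
  refine ⟨8 * 2 ^ α, by positivity, ?_⟩
  filter_upwards [ht.eventually hu, hl, hr', eventually_gt_atTop 0] with k h1 h2 h3 hk
  have hk' : (0 : ℝ) < k := by positivity
  have hk2 : (0 : ℝ) < ((2 * k + i : ℕ) : ℝ) := by positivity
  rw [div_lt_iff₀ (by positivity)] at h1
  rw [lt_div_iff₀ (by positivity)] at h2
  rw [Real.div_rpow hk2.le hk'.le, div_lt_iff₀ (by positivity)] at h3
  calc g (2 * k + i) ≤ 2 * c * ((2 * k + i : ℕ) : ℝ) ^ α := h1.le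
    _ ≤ 2 * c * (2 * 2 ^ α * (k : ℝ) ^ α) := by gcongr
    _ = 8 * 2 ^ α * (c / 2 * (k : ℝ) ^ α) := by ring
    _ ≤ 8 * 2 ^ α * g k := by gcongr

/-- The partial sums of an admissible weight have the doubling property. -/
lemma exists_doubling (hg : ∀ k, 0 ≤ g k) (h0 : 0 < g 0)
    (h : (∃ α c : ℝ, 0 < c ∧ Tendsto (fun k : ℕ => g k / (k : ℝ) ^ α) atTop (𝓝 c)) ∨
      Summable g) :
    ∃ D : ℝ, 0 < D ∧ ∀ m, G g (2 * m + 1) ≤ D * G g m := by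
  have hG := G_pos hg h0
  have hGm : ∀ m, g 0 ≤ G g m := fun m => (G_zero g).symm.le.trans (G_mono hg (Nat.zero_le m))
  rcases h with ⟨α, c, hc, h⟩ | h
  · obtain ⟨D₀, hD₀, h₀⟩ := eventually_le_mul_of_tendsto_div_rpow hc h 0
    obtain ⟨D₁, hD₁, h₁⟩ := eventually_le_mul_of_tendsto_div_rpow hc h 1
    obtain ⟨k₀, hk₀⟩ := eventually_atTop.1 (h₀.and h₁)
    -- The comparison of `g(2k)`, `g(2k+1)` with `g(k)` holds only from `k₀` on, where `g` may have
    -- vanished before. The initial segment costs an additive constant, turned into a multiplicative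
    -- one by `g 0 ≤ G(m)`.
    refine ⟨(D₀ + D₁) + G g (2 * k₀ + 1) / g 0, by have := hG (2 * k₀ + 1); positivity, ?_⟩
    intro m
    have key : G g (2 * m + 1) ≤ (D₀ + D₁) * G g m + G g (2 * k₀ + 1) := by
      induction m with
      | zero =>
        have := G_mono hg (show 2 * 0 + 1 ≤ 2 * k₀ + 1 by omega)
        have := mul_pos (add_pos hD₀ hD₁) (hG 0)
        linarith
      | succ m ih =>
        rcases le_or_gt k₀ (m + 1) with hm | hm
        · have := hk₀ (m + 1) hm
          rw [show 2 * (m + 1) + 1 = 2 * m + 1 + 1 + 1 by ring, G_succ, G_succ g (2 * m + 1),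
            G_succ g m]
          rw [show 2 * (m + 1) + 0 = 2 * m + 1 + 1 by ring,
            show 2 * (m + 1) + 1 = 2 * m + 1 + 1 + 1 by ring] at this
          linarith [this.1, this.2]
        · have := G_mono hg (show 2 * (m + 1) + 1 ≤ 2 * k₀ + 1 by omega)
          have := mul_pos (add_pos hD₀ hD₁) (hG (m + 1))
          linarith
    refine key.trans ?_
    rw [add_mul (D₀ + D₁)]
    refine add_le_add le_rfl ?_
    rw [div_mul_eq_mul_div, le_div_iff₀ h0]
    exact mul_le_mul_of_nonneg_left (hGm m) (hG _).le
  · have hT : ∀ m, G g m ≤ ∑' k, g k := fun m => h.sum_le_tsum _ fun k _ => hg k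
    have hT0 : 0 < ∑' k, g k := (hG 0).trans_le (hT 0)
    refine ⟨(∑' k, g k) / g 0, by positivity, fun m => ?_⟩
    rw [div_mul_eq_mul_div, le_div_iff₀ h0]
    exact mul_le_mul (hT _) (hGm m) h0.le hT0.le

/-- Doubling forces polynomial growth. -/
lemma exists_G_le_pow (hg : ∀ k, 0 ≤ g k) (h0 : 0 < g 0) {D : ℝ}
    (h : ∀ m, G g (2 * m + 1) ≤ D * G g m) : ∃ q : ℕ, ∀ k, G g k ≤ g 0 * ((k : ℝ) + 1) ^ q := by
  -- The ratio is `3/2` rather than `2` because `⌊k/2⌋ + 1 ≤ (2/3)(k + 1)` for `k ≥ 1`, with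
  -- equality at `k = 2`.
  obtain ⟨q, hq⟩ := pow_unbounded_of_one_lt D (show (1 : ℝ) < 3 / 2 by norm_num)
  refine ⟨q, fun k => ?_⟩
  induction k using Nat.strong_induction_on with
  | _ k ih =>
    rcases Nat.eq_zero_or_pos k with rfl | hk
    · simp [G_zero]
    · have h1 := ih (k / 2) (by omega)
      have h2 : (3 / 2 : ℝ) * (((k / 2 : ℕ) : ℝ) + 1) ≤ k + 1 := by
        have : 3 * (k / 2 + 1) ≤ 2 * (k + 1) := by omega
        have : (3 : ℝ) * (((k / 2 : ℕ) : ℝ) + 1) ≤ 2 * (k + 1) := by exact_mod_cast this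
        linarith
      calc G g k ≤ G g (2 * (k / 2) + 1) := G_mono hg (by omega)
        _ ≤ D * G g (k / 2) := h _
        _ ≤ (3 / 2) ^ q * (g 0 * (((k / 2 : ℕ) : ℝ) + 1) ^ q) :=
          mul_le_mul hq.le h1 (G_pos hg h0 _).le (by positivity)
        _ = g 0 * ((3 / 2) * (((k / 2 : ℕ) : ℝ) + 1)) ^ q := by rw [mul_pow]; ring
        _ ≤ g 0 * ((k : ℝ) + 1) ^ q := by gcongr

lemma summable_pow_mul_G (hg : ∀ k, 0 ≤ g k) (h0 : 0 < g 0) {D : ℝ}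
    (h : ∀ m, G g (2 * m + 1) ≤ D * G g m) (n : ℕ) {s : ℝ} (hs0 : 0 ≤ s) (hs1 : s < 1) :
    Summable fun k : ℕ => (k : ℝ) ^ n * s ^ k * G g k := by
  obtain ⟨q, hq⟩ := exists_G_le_pow hg h0 h
  obtain ⟨r, hsr, hr1⟩ := exists_between hs1
  have hr0 : 0 < r := hs0.trans_lt hsr
  have hsum : Summable fun k : ℕ => (k : ℝ) ^ (n + q) * r ^ k :=
    summable_pow_mul_geometric_of_norm_lt_one (n + q) (by rwa [Real.norm_of_nonneg hr0.le])
  have hsum' := ((summable_nat_add_iff 1).2 hsum).mul_left (g 0 / r)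
  refine Summable.of_nonneg_of_le (fun k => ?_) (fun k => ?_) hsum'
  · have := (G_pos hg h0 k).le
    positivity
  · calc (k : ℝ) ^ n * s ^ k * G g k
        ≤ ((k : ℝ) + 1) ^ n * r ^ k * (g 0 * ((k : ℝ) + 1) ^ q) := by
          gcongr
          · exact (G_pos hg h0 k).le
          · linarith
          · exact hq k
      _ = g 0 / r * (((k + 1 : ℕ) : ℝ) ^ (n + q) * r ^ (k + 1)) := by
          push_cast
          field_simp
          ring

lemma Q_zero_pos (hg : ∀ k, 0 ≤ g k) (h0 : 0 < g 0) {D : ℝ}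
    (h : ∀ m, G g (2 * m + 1) ≤ D * G g m) {s : ℝ} (hs0 : 0 ≤ s) (hs1 : s < 1) :
    0 < Q g 0 s := by
  refine (summable_pow_mul_G hg h0 h 0 hs0 hs1).tsum_pos (fun k => ?_) 0 ?_
  · have := (G_pos hg h0 k).le
    positivity
  · simpa using G_pos hg h0 0

/-- With `x = k(1-r)`, this combines `r^k ≤ e^{-x}` and `x^n / n! ≤ e^x`. -/
lemma pow_mul_pow_le (n k : ℕ) {r : ℝ} (hr0 : 0 ≤ r) (hr1 : r < 1) :
    (k : ℝ) ^ n * r ^ k ≤ n.factorial / (1 - r) ^ n := by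
  have h1 : 0 < 1 - r := by linarith
  have h2 : r ^ k ≤ Real.exp (-(k * (1 - r))) := by
    rw [show -((k : ℝ) * (1 - r)) = k * (r - 1) by ring, Real.exp_nat_mul]
    gcongr
    linarith [Real.add_one_le_exp (r - 1)]
  have h3 := Real.pow_div_factorial_le_exp (x := k * (1 - r)) (by positivity) n
  rw [le_div_iff₀ (by positivity)]
  have h4 : (k * (1 - r)) ^ n * Real.exp (-(k * (1 - r))) ≤ n.factorial := by
    rw [Real.exp_neg, ← div_eq_mul_inv, div_le_iff₀ (Real.exp_pos _)]
    rw [div_le_iff₀ (by positivity)] at h3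
    linarith
  calc (k : ℝ) ^ n * r ^ k * (1 - r) ^ n = (k * (1 - r)) ^ n * r ^ k := by rw [mul_pow]; ring
    _ ≤ (k * (1 - r)) ^ n * Real.exp (-(k * (1 - r))) := by gcongr
    _ ≤ _ := h4

/-- The moments of the exponential family are of the order of powers of `1 / (1 - s)`. -/
lemma Q_le (hg : ∀ k, 0 ≤ g k) (h0 : 0 < g 0) {D : ℝ}
    (h : ∀ m, G g (2 * m + 1) ≤ D * G g m) (n : ℕ) {s : ℝ} (hs0 : 0 ≤ s) (hs1 : s < 1) :
    Q g n s ≤ n.factorial * 2 ^ (n + 1) * D / (1 - s) ^ n * Q g 0 s := by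
  -- Write `s^k = r^k r^k`: one factor absorbs `k^n`, at the price of `n!/(1-r)^n` with `1 - r ≥
  -- (1-s)/2`. The other leaves the sum at radius `√s`, which doubling brings back to radius `s` by
  -- pairing the indices `2k` and `2k+1`.
  obtain ⟨r, hr0, hrs⟩ : ∃ r : ℝ, 0 ≤ r ∧ r ^ 2 = s := ⟨√s, Real.sqrt_nonneg s, Real.sq_sqrt hs0⟩
  have hr1 : r < 1 := by nlinarith
  have hG := G_pos hg h0
  have hsr := summable_pow_mul_G hg h0 h 0 hr0 hr1
  have hss := summable_pow_mul_G hg h0 h 0 hs0 hs1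
  simp only [pow_zero, one_mul] at hsr hss
  have hfac : (n.factorial : ℝ) / (1 - r) ^ n ≤ n.factorial * 2 ^ n / (1 - s) ^ n := by
    have h1 : 0 < 1 - s := by linarith
    have h2 : (1 - s) / 2 ≤ 1 - r := by nlinarith
    calc (n.factorial : ℝ) / (1 - r) ^ n ≤ n.factorial / ((1 - s) / 2) ^ n := by gcongr
      _ = _ := by rw [div_pow]; field_simp
  have step1 : Q g n s ≤ n.factorial * 2 ^ n / (1 - s) ^ n * ∑' k : ℕ, r ^ k * G g k := by
    rw [Q, ← tsum_mul_left]
    refine (summable_pow_mul_G hg h0 h n hs0 hs1).tsum_le_tsum (fun k => ?_) (hsr.mul_left _)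
    calc (k : ℝ) ^ n * s ^ k * G g k = ((k : ℝ) ^ n * r ^ k) * (r ^ k * G g k) := by
          rw [← hrs]; ring
      _ ≤ _ := by
          have := (hG k).le
          gcongr
          exact (pow_mul_pow_le n k hr0 hr1).trans hfac
  have step2 : ∑' k : ℕ, r ^ k * G g k ≤ 2 * D * ∑' k : ℕ, s ^ k * G g k := by
    have he : Summable fun k : ℕ => r ^ (2 * k) * G g (2 * k) :=
      hsr.comp_injective (mul_right_injective₀ two_ne_zero)
    have ho : Summable fun k : ℕ => r ^ (2 * k + 1) * G g (2 * k + 1) :=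
      hsr.comp_injective ((add_left_injective 1).comp (mul_right_injective₀ two_ne_zero))
    rw [← tsum_even_add_odd (f := fun k : ℕ => r ^ k * G g k) he ho, ← he.tsum_add ho, ← tsum_mul_left]
    refine (he.add ho).tsum_le_tsum (fun k => ?_) (hss.mul_left _)
    have h1 : r ^ (2 * k) = s ^ k := by rw [pow_mul, hrs]
    have h2 : r ^ (2 * k + 1) ≤ s ^ k := by
      rw [← h1]; exact pow_le_pow_of_le_one hr0 hr1.le (by omega)
    have h3 : G g (2 * k) ≤ D * G g k := (G_mono hg (by omega)).trans (h k)
    have h4 : r ^ (2 * k + 1) * G g (2 * k + 1) ≤ s ^ k * (D * G g k) :=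
      mul_le_mul h2 (h k) (hG _).le (by positivity)
    have h5 : r ^ (2 * k) * G g (2 * k) ≤ s ^ k * (D * G g k) := by rw [h1]; gcongr
    linarith
  refine step1.trans ?_
  have h1 : 0 < 1 - s := by linarith
  calc _ ≤ n.factorial * 2 ^ n / (1 - s) ^ n * (2 * D * ∑' k : ℕ, s ^ k * G g k) := by gcongr
    _ = _ := by simp only [Q, pow_zero, one_mul]; ring

/-- Monotonicity of `G` makes the normalized generating function on the circle of radius `s`
no larger than that of the geometric distribution. -/
lemma norm_tsum_pow_mul_G_le (hg : ∀ k, 0 ≤ g k) (h0 : 0 < g 0) {D : ℝ}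
    (h : ∀ m, G g (2 * m + 1) ≤ D * G g m) {z : ℂ} (hz1 : ‖z‖ < 1) :
    ‖1 - z‖ * ‖∑' k : ℕ, z ^ k * (G g k : ℂ)‖ ≤ (1 - ‖z‖) * Q g 0 ‖z‖ := by
  have hG := G_pos hg h0
  -- Abel summation: `(1-w) ∑ w^k G(k) = ∑ w^k g(k)`. Since `g ≥ 0`, the triangle inequality
  -- compares the value at `z` with the value at `‖z‖`.
  have key : ∀ w : ℂ, ‖w‖ < 1 → (Summable fun k : ℕ => w ^ (k + 1) * (g (k + 1) : ℂ)) ∧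
      (1 - w) * ∑' k : ℕ, w ^ k * (G g k : ℂ) =
        g 0 + ∑' k : ℕ, w ^ (k + 1) * (g (k + 1) : ℂ) := by
    intro w hw
    have hs : Summable fun k : ℕ => w ^ k * (G g k : ℂ) := by
      refine Summable.of_norm ?_
      have := summable_pow_mul_G hg h0 h 0 (norm_nonneg w) hw
      refine this.congr fun k => ?_
      simp [abs_of_pos (hG k)]
    have hs1 := (summable_nat_add_iff 1).2 hs
    have hs2 := hs.mul_left w
    have heq : (fun k : ℕ => w ^ (k + 1) * (g (k + 1) : ℂ)) =
        fun k => w ^ (k + 1) * (G g (k + 1) : ℂ) - w * (w ^ k * (G g k : ℂ)) := by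
      ext k
      rw [G_succ]
      push_cast
      ring
    refine ⟨heq ▸ hs1.sub hs2, ?_⟩
    rw [heq, hs1.tsum_sub hs2, tsum_mul_left, sub_mul, one_mul]
    have h2 := hs.tsum_eq_zero_add
    rw [pow_zero, one_mul, G_zero] at h2
    linear_combination h2
  obtain ⟨hz, hz'⟩ := key z hz1
  obtain ⟨hr, hr'⟩ := key (‖z‖ : ℂ) (by simpa using hz1)
  have hr'' : (1 - ‖z‖) * Q g 0 ‖z‖ = g 0 + ∑' k : ℕ, ‖z‖ ^ (k + 1) * g (k + 1) := by
    have : ((1 - ‖z‖ : ℝ) : ℂ) * ((Q g 0 ‖z‖ : ℝ) : ℂ) =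
        ((g 0 + ∑' k : ℕ, ‖z‖ ^ (k + 1) * g (k + 1) : ℝ) : ℂ) := by
      simp only [Q, pow_zero, one_mul]
      push_cast
      exact hr'
    exact_mod_cast this
  have hr2 : Summable fun k : ℕ => ‖z‖ ^ (k + 1) * g (k + 1) := by
    exact_mod_cast hr
  rw [← norm_mul, hz', hr'']
  have hn : ∀ k : ℕ, ‖z ^ (k + 1) * (g (k + 1) : ℂ)‖ = ‖z‖ ^ (k + 1) * g (k + 1) := fun k => by
    simp [abs_of_nonneg (hg (k + 1))]
  refine (norm_add_le _ _).trans (add_le_add ?_ ?_)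
  · simp [abs_of_pos h0]
  · refine (norm_tsum_le_tsum_norm (by simpa only [hn] using hr2)).trans_eq ?_
    simp only [hn]

end Series

end MoneyExchange

namespace MoneyExchange

/-! ### Characteristic functions and moments of laws on `ℕ` -/

section CharFun

lemma norm_cexp_mul_I_sub_taylor_le (x : ℝ) :
    ‖Complex.exp (x * Complex.I) - (1 + x * Complex.I - x ^ 2 / 2)‖ ≤ 4 * |x| ^ 3 := by
  have hn : ‖(x : ℂ) * Complex.I‖ = |x| := by simp
  rcases le_or_gt |x| 1 with hx | hx
  · have h := Complex.norm_exp_sub_sum_le_norm_mul_exp (x * Complex.I) 3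
    have hs : ∑ m ∈ Finset.range 3, ((x : ℂ) * Complex.I) ^ m / (m.factorial : ℂ) =
        1 + x * Complex.I - x ^ 2 / 2 := by
      simp [Finset.sum_range_succ, mul_pow]
      ring
    rw [hs, hn] at h
    have he : Real.exp |x| ≤ 4 := by
      have := Real.exp_le_exp.2 hx
      have := Real.exp_one_lt_d9
      linarith
    calc _ ≤ |x| ^ 3 * Real.exp |x| := h
      _ ≤ |x| ^ 3 * 4 := by gcongr
      _ = _ := by ring
  · have h1 : ‖Complex.exp (x * Complex.I)‖ = 1 := Complex.norm_exp_ofReal_mul_I x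
    have h2 : ‖(x : ℂ) ^ 2 / 2‖ = |x| ^ 2 / 2 := by simp
    have h3 : ‖Complex.exp (x * Complex.I) - (1 + x * Complex.I - x ^ 2 / 2)‖ ≤
        1 + (1 + |x| + |x| ^ 2 / 2) := by
      refine (norm_sub_le _ _).trans ?_
      rw [h1]
      gcongr
      refine (norm_sub_le _ _).trans ?_
      rw [h2]
      gcongr
      refine (norm_add_le _ _).trans ?_
      rw [hn]
      simp
    nlinarith [pow_pos (zero_lt_one.trans hx) 2, sq_nonneg (|x| - 1)]

variable {μ : Measure ℕ} [IsProbabilityMeasure μ]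

lemma charFun_map_natCast (μ : Measure ℕ) (t : ℝ) :
    charFun (μ.map (Nat.cast : ℕ → ℝ)) t = ∫ k, Complex.exp (t * k * Complex.I) ∂μ := by
  rw [charFun_apply_real, integral_map (by fun_prop) (by fun_prop)]
  simp

lemma integrable_cexp (t m : ℝ) :
    Integrable (fun k : ℕ => Complex.exp ((t * (k - m) : ℝ) * Complex.I)) μ :=
  Integrable.of_bound (C := 1) (by fun_prop) (ae_of_all _ fun k => by
    rw [Complex.norm_exp_ofReal_mul_I])

lemma integrable_natCast_pow_of_le {p q : ℕ} (hpq : p ≤ q)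
    (h : Integrable (fun k : ℕ => (k : ℝ) ^ q) μ) : Integrable (fun k : ℕ => (k : ℝ) ^ p) μ := by
  refine ((integrable_const 1).add h).mono' (by fun_prop) (ae_of_all _ fun k => ?_)
  simp only [Pi.add_apply, Real.norm_eq_abs, abs_of_nonneg (by positivity : (0 : ℝ) ≤ (k : ℝ) ^ p)]
  rcases Nat.eq_zero_or_pos k with rfl | hk
  · have : (0 : ℝ) ^ p ≤ 1 := pow_le_one₀ le_rfl zero_le_one
    have : (0 : ℝ) ≤ 0 ^ q := by positivity
    push_cast
    linarith
  · have : (k : ℝ) ^ p ≤ (k : ℝ) ^ q := pow_le_pow_right₀ (by exact_mod_cast hk) hpq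
    linarith

lemma cexp_mul_charFun (μ : Measure ℕ) (t m : ℝ) :
    Complex.exp ((-(t * m) : ℝ) * Complex.I) * charFun (μ.map (Nat.cast : ℕ → ℝ)) t =
      ∫ k : ℕ, Complex.exp ((t * (k - m) : ℝ) * Complex.I) ∂μ := by
  rw [charFun_map_natCast, ← integral_const_mul]
  congr 1
  ext k
  rw [← Complex.exp_add]
  push_cast
  ring_nf

lemma norm_cexp_mul_charFun (μ : Measure ℕ) (t m : ℝ) :
    ‖Complex.exp ((-(t * m) : ℝ) * Complex.I) * charFun (μ.map (Nat.cast : ℕ → ℝ)) t‖ =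
      ‖charFun (μ.map (Nat.cast : ℕ → ℝ)) t‖ := by
  rw [norm_mul, Complex.norm_exp_ofReal_mul_I, one_mul]

/-- Used in reverse: a characteristic function away from `1` in modulus at frequency `t` gives a
lower bound of order `1/|t|` on the mean. -/
lemma one_sub_norm_charFun_le_mean (h : Integrable (fun k : ℕ => (k : ℝ)) μ) (t : ℝ) :
    1 - ‖charFun (μ.map (Nat.cast : ℕ → ℝ)) t‖ ≤ |t| * ∫ k, (k : ℝ) ∂μ := by
  have h1 : ‖1 - ∫ k : ℕ, Complex.exp ((t * (k - 0) : ℝ) * Complex.I) ∂μ‖ ≤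
      |t| * ∫ k, (k : ℝ) ∂μ := by
    have h2 : 1 - ∫ k : ℕ, Complex.exp ((t * (k - 0) : ℝ) * Complex.I) ∂μ =
        ∫ k : ℕ, (1 - Complex.exp ((t * (k - 0) : ℝ) * Complex.I)) ∂μ := by
      rw [integral_sub (integrable_const _) (integrable_cexp t 0)]
      simp
    rw [h2, ← integral_const_mul]
    refine norm_integral_le_of_norm_le (h.const_mul _) (ae_of_all _ fun k => ?_)
    rw [norm_sub_rev, mul_comm _ Complex.I]
    refine (Real.norm_exp_I_mul_ofReal_sub_one_le).trans_eq ?_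
    simp
  have h3 := norm_sub_norm_le (1 : ℂ) (∫ k : ℕ, Complex.exp ((t * (k - 0) : ℝ) * Complex.I) ∂μ)
  rw [← cexp_mul_charFun, norm_cexp_mul_charFun, norm_one] at h3
  rw [← cexp_mul_charFun] at h1
  linarith

lemma variance_natCast (μ : Measure ℕ) :
    variance (fun k : ℕ => (k : ℝ)) μ = ∫ k : ℕ, ((k : ℝ) - ∫ j, (j : ℝ) ∂μ) ^ 2 ∂μ :=
  variance_eq_integral (by fun_prop)

lemma integrable_sq_sub (h : Integrable (fun k : ℕ => (k : ℝ) ^ 2) μ) (m : ℝ) :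
    Integrable (fun k : ℕ => ((k : ℝ) - m) ^ 2) μ := by
  have h1 : Integrable (fun k : ℕ => (k : ℝ)) μ := by
    simpa using integrable_natCast_pow_of_le (p := 1) (by norm_num) h
  refine ((h.sub (h1.const_mul (2 * m))).add (integrable_const (m ^ 2))).congr
    (ae_of_all _ fun k => ?_)
  simp only [Pi.add_apply, Pi.sub_apply]
  ring

/-- Take the real part after centering and use `cos x ≥ 1 - x^2/2`. Like the mean estimate, this
serves as a lower bound, here on the variance. -/
lemma two_mul_one_sub_norm_charFun_le_variance (h : Integrable (fun k : ℕ => (k : ℝ) ^ 2) μ)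
    (t : ℝ) :
    2 * (1 - ‖charFun (μ.map (Nat.cast : ℕ → ℝ)) t‖) ≤
      t ^ 2 * variance (fun k : ℕ => (k : ℝ)) μ := by
  rw [variance_natCast]
  set m := ∫ j : ℕ, (j : ℝ) ∂μ
  have h1 := integrable_sq_sub h m
  have h2 : 1 - t ^ 2 / 2 * ∫ k : ℕ, ((k : ℝ) - m) ^ 2 ∂μ ≤
      (∫ k : ℕ, Complex.exp ((t * (k - m) : ℝ) * Complex.I) ∂μ).re := by
    have h3 : (∫ k : ℕ, Complex.exp ((t * (k - m) : ℝ) * Complex.I) ∂μ).re =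
        ∫ k : ℕ, (Complex.exp ((t * (k - m) : ℝ) * Complex.I)).re ∂μ :=
      ((RCLike.reCLM (K := ℂ)).integral_comp_comm (integrable_cexp t m)).symm
    have h4 : 1 - t ^ 2 / 2 * ∫ k : ℕ, ((k : ℝ) - m) ^ 2 ∂μ =
        ∫ k : ℕ, (1 - t ^ 2 / 2 * ((k : ℝ) - m) ^ 2) ∂μ := by
      rw [integral_sub (integrable_const _) (h1.const_mul _), integral_const_mul]
      simp
    rw [h3, h4]
    refine integral_mono ((integrable_const _).sub (h1.const_mul _)) (integrable_cexp t m).re ?_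
    intro k
    have := Real.one_sub_sq_div_two_le_cos (x := t * (k - m))
    simp only [Complex.exp_ofReal_mul_I_re]
    nlinarith
  have h5 := (Complex.re_le_norm _).trans_eq (norm_cexp_mul_charFun μ t m)
  rw [cexp_mul_charFun] at h5
  linarith

/-- Second order expansion of the characteristic function of the centered variable. -/
lemma norm_charFun_sub_le (h : Integrable (fun k : ℕ => (k : ℝ) ^ 3) μ) {m : ℝ}
    (hm : ∫ k, (k : ℝ) ∂μ = m) (t : ℝ) :
    ‖Complex.exp ((-(t * m) : ℝ) * Complex.I) * charFun (μ.map (Nat.cast : ℕ → ℝ)) t -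
        ((1 - t ^ 2 / 2 * variance (fun k : ℕ => (k : ℝ)) μ : ℝ) : ℂ)‖ ≤
      4 * |t| ^ 3 * (∫ k, (k : ℝ) ^ 3 ∂μ + m ^ 3) := by
  have hm0 : 0 ≤ m := hm ▸ integral_nonneg fun k => Nat.cast_nonneg k
  have h1 : Integrable (fun k : ℕ => (k : ℝ)) μ := by
    simpa using integrable_natCast_pow_of_le (p := 1) (by norm_num) h
  have h2 := integrable_sq_sub (integrable_natCast_pow_of_le (p := 2) (by norm_num) h) m
  have hc : Integrable (fun k : ℕ => (1 : ℂ) + (t * (k - m) : ℝ) * Complex.I) μ :=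
    (integrable_const _).add (((h1.sub (integrable_const m)).const_mul t).ofReal.mul_const _)
  have hd : Integrable (fun k : ℕ => ((t * (k - m) : ℝ) : ℂ) ^ 2 / 2) μ := by
    refine ((h2.const_mul (t ^ 2)).ofReal (𝕜 := ℂ)|>.div_const 2).congr (ae_of_all _ fun k => ?_)
    simp only [RCLike.ofReal_mul, RCLike.ofReal_pow, Complex.coe_algebraMap]
    push_cast
    simp [mul_pow]
  have h3 : (((1 - t ^ 2 / 2 * variance (fun k : ℕ => (k : ℝ)) μ : ℝ)) : ℂ) =
      ∫ k : ℕ, (1 + (t * (k - m) : ℝ) * Complex.I - ((t * (k - m) : ℝ) : ℂ) ^ 2 / 2) ∂μ := by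
    rw [integral_sub hc hd, integral_add (integrable_const _)
      (((h1.sub (integrable_const m)).const_mul t).ofReal.mul_const _), integral_mul_const,
      integral_complex_ofReal, integral_const_mul, integral_sub h1 (integrable_const m), hm,
      variance_natCast, hm, integral_div]
    have h4 : ∫ k : ℕ, ((t * (k - m) : ℝ) : ℂ) ^ 2 ∂μ =
        ((t ^ 2 * ∫ k : ℕ, ((k : ℝ) - m) ^ 2 ∂μ : ℝ) : ℂ) := by
      rw [← integral_const_mul, ← integral_complex_ofReal]
      congr 1
      ext k
      push_cast
      ring
    rw [h4]
    simp
    ring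
  rw [cexp_mul_charFun, h3, ← integral_sub (integrable_cexp t m) (by exact hc.sub hd)]
  have h5 : 4 * |t| ^ 3 * (∫ k, (k : ℝ) ^ 3 ∂μ + m ^ 3) =
      ∫ k : ℕ, 4 * |t| ^ 3 * ((k : ℝ) ^ 3 + m ^ 3) ∂μ := by
    rw [integral_const_mul, integral_add h (integrable_const _)]
    simp
  rw [h5]
  refine norm_integral_le_of_norm_le ((h.add (integrable_const _)).const_mul _)
    (ae_of_all _ fun k => ?_)
  refine (norm_cexp_mul_I_sub_taylor_le (t * (k - m))).trans ?_
  rw [abs_mul, mul_pow, ← mul_assoc]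
  gcongr
  have hk : (0 : ℝ) ≤ k := Nat.cast_nonneg k
  -- For nonnegative `k` and `m`, `|k - m|^3 ≤ max(k, m)^3 ≤ k^3 + m^3`, so raw moments suffice.
  rcases le_total (k : ℝ) m with hkm | hkm
  · rw [abs_of_nonpos (by linarith)]
    have : (-((k : ℝ) - m)) ^ 3 ≤ m ^ 3 := pow_le_pow_left₀ (by linarith) (by linarith) 3
    have : 0 ≤ (k : ℝ) ^ 3 := by positivity
    linarith
  · rw [abs_of_nonneg (by linarith)]
    have : ((k : ℝ) - m) ^ 3 ≤ (k : ℝ) ^ 3 := pow_le_pow_left₀ (by linarith) (by linarith) 3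
    have : 0 ≤ m ^ 3 := by positivity
    linarith

end CharFun

/-! ### The exponential family `ν_s` -/

section ExponentialFamily

variable {g : ℕ → ℝ}

lemma weight_nonneg (hg : ∀ k, 0 ≤ g k) (h0 : 0 < g 0) {D : ℝ}
    (h : ∀ m, G g (2 * m + 1) ≤ D * G g m) {s : ℝ} (hs0 : 0 ≤ s) (hs1 : s < 1) (k : ℕ) :
    0 ≤ s ^ k * G g k / Q g 0 s := by
  have := G_pos hg h0 k
  have := Q_zero_pos hg h0 h hs0 hs1
  positivity

lemma isProbabilityMeasure_nu (hg : ∀ k, 0 ≤ g k) (h0 : 0 < g 0) {D : ℝ}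
    (h : ∀ m, G g (2 * m + 1) ≤ D * G g m) {s : ℝ} (hs0 : 0 ≤ s) (hs1 : s < 1) :
    IsProbabilityMeasure (nu g s) := by
  refine ⟨?_⟩
  have hs := summable_pow_mul_G hg h0 h 0 hs0 hs1
  simp only [pow_zero, one_mul] at hs
  rw [nu, Measure.sum_apply _ MeasurableSet.univ]
  simp only [Measure.smul_apply, measure_univ, smul_eq_mul, mul_one]
  rw [← ENNReal.ofReal_tsum_of_nonneg (weight_nonneg hg h0 h hs0 hs1) (hs.div_const _),
    tsum_div_const]
  have := Q_zero_pos hg h0 h hs0 hs1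
  rw [show ∑' k : ℕ, s ^ k * G g k = Q g 0 s by simp [Q], div_self this.ne', ENNReal.ofReal_one]

lemma integrable_pow_nu (hg : ∀ k, 0 ≤ g k) (h0 : 0 < g 0) {D : ℝ}
    (h : ∀ m, G g (2 * m + 1) ≤ D * G g m) {s : ℝ} (hs0 : 0 ≤ s) (hs1 : s < 1) (n : ℕ) :
    Integrable (fun k : ℕ => (k : ℝ) ^ n) (nu g s) := by
  refine integrable_sum_dirac (by simp) ?_
  refine ((summable_pow_mul_G hg h0 h n hs0 hs1).div_const (Q g 0 s)).congr fun k => ?_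
  rw [ENNReal.toReal_ofReal (weight_nonneg hg h0 h hs0 hs1 k), Real.norm_of_nonneg (by positivity)]
  ring

lemma integral_pow_nu (hg : ∀ k, 0 ≤ g k) (h0 : 0 < g 0) {D : ℝ}
    (h : ∀ m, G g (2 * m + 1) ≤ D * G g m) {s : ℝ} (hs0 : 0 ≤ s) (hs1 : s < 1) (n : ℕ) :
    ∫ k, (k : ℝ) ^ n ∂(nu g s) = Q g n s / Q g 0 s := by
  rw [nu, integral_sum_dirac (by simp), Q.eq_1 g n, ← tsum_div_const]
  congr 1
  ext k
  rw [ENNReal.toReal_ofReal (weight_nonneg hg h0 h hs0 hs1 k), smul_eq_mul]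
  ring

lemma integral_pow_nu_le (hg : ∀ k, 0 ≤ g k) (h0 : 0 < g 0) {D : ℝ}
    (h : ∀ m, G g (2 * m + 1) ≤ D * G g m) {s : ℝ} (hs0 : 0 ≤ s) (hs1 : s < 1) (n : ℕ) :
    ∫ k, (k : ℝ) ^ n ∂(nu g s) ≤ n.factorial * 2 ^ (n + 1) * D / (1 - s) ^ n := by
  rw [integral_pow_nu hg h0 h hs0 hs1, div_le_iff₀ (Q_zero_pos hg h0 h hs0 hs1)]
  exact Q_le hg h0 h n hs0 hs1

lemma charFun_nu (hg : ∀ k, 0 ≤ g k) (h0 : 0 < g 0) {D : ℝ}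
    (h : ∀ m, G g (2 * m + 1) ≤ D * G g m) {s : ℝ} (hs0 : 0 ≤ s) (hs1 : s < 1) (t : ℝ) :
    charFun ((nu g s).map (Nat.cast : ℕ → ℝ)) t =
      (∑' k : ℕ, (s * Complex.exp (t * Complex.I)) ^ k * (G g k : ℂ)) / Q g 0 s := by
  rw [charFun_map_natCast, nu, integral_sum_dirac (by simp), ← tsum_div_const]
  congr 1
  ext k
  rw [ENNReal.toReal_ofReal (weight_nonneg hg h0 h hs0 hs1 k), mul_pow, ← Complex.exp_nat_mul,
    Complex.real_smul]
  push_cast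
  ring_nf

/-- Combine the Abel bound with `|1 - s e^{it}|^2 = (1-s)^2 + 2s(1 - cos t)`, where `2s ≥ 1` and `1
- cos t ≥ 2t^2/π^2` on `[-π, π]`. -/
lemma sq_norm_charFun_nu_le (hg : ∀ k, 0 ≤ g k) (h0 : 0 < g 0) {D : ℝ}
    (h : ∀ m, G g (2 * m + 1) ≤ D * G g m) {s : ℝ} (hs0 : 1 / 2 ≤ s) (hs1 : s < 1) {t : ℝ}
    (ht : |t| ≤ Real.pi) :
    ‖charFun ((nu g s).map (Nat.cast : ℕ → ℝ)) t‖ ^ 2 ≤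
      1 / (1 + 2 / Real.pi ^ 2 * (t ^ 2 / (1 - s) ^ 2)) := by
  have hs : 0 ≤ s := by linarith
  have hQ := Q_zero_pos hg h0 h hs hs1
  set z : ℂ := s * Complex.exp (t * Complex.I) with hz
  have hzn : ‖z‖ = s := by
    rw [hz, norm_mul, Complex.norm_exp_ofReal_mul_I, mul_one, Complex.norm_real,
      Real.norm_of_nonneg hs]
  have h1 := norm_tsum_pow_mul_G_le hg h0 h (z := z) (by rwa [hzn])
  rw [hzn] at h1
  have h2 : ‖charFun ((nu g s).map (Nat.cast : ℕ → ℝ)) t‖ =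
      ‖∑' k : ℕ, z ^ k * (G g k : ℂ)‖ / Q g 0 s := by
    rw [charFun_nu hg h0 h hs hs1, norm_div, Complex.norm_real, Real.norm_of_nonneg hQ.le]
  have h3 : ‖1 - z‖ * ‖charFun ((nu g s).map (Nat.cast : ℕ → ℝ)) t‖ ≤ 1 - s := by
    rw [h2, ← mul_div_assoc, div_le_iff₀ hQ]
    exact h1
  have h4 : ‖1 - z‖ ^ 2 = (1 - s) ^ 2 + 2 * s * (1 - Real.cos t) := by
    rw [← Complex.normSq_eq_norm_sq, Complex.normSq_apply, hz]
    simp only [Complex.sub_re, Complex.sub_im, Complex.one_re, Complex.one_im, Complex.re_ofReal_mul,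
      Complex.im_ofReal_mul, Complex.exp_ofReal_mul_I_re, Complex.exp_ofReal_mul_I_im]
    nlinarith [Real.sin_sq_add_cos_sq t]
  have h5 := Real.cos_le_one_sub_mul_cos_sq ht
  have h6 : (1 - s) ^ 2 + 2 / Real.pi ^ 2 * t ^ 2 ≤ ‖1 - z‖ ^ 2 := by
    rw [h4]
    have : 0 ≤ 2 / Real.pi ^ 2 * t ^ 2 := by positivity
    nlinarith
  have h7 : ‖1 - z‖ ^ 2 * ‖charFun ((nu g s).map (Nat.cast : ℕ → ℝ)) t‖ ^ 2 ≤ (1 - s) ^ 2 := by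
    rw [← mul_pow]
    exact pow_le_pow_left₀ (by positivity) h3 2
  have ha : 0 < (1 - s) ^ 2 := by
    have : 0 < 1 - s := by linarith
    positivity
  rw [le_div_iff₀ (by positivity)]
  have h8 : ((1 - s) ^ 2 + 2 / Real.pi ^ 2 * t ^ 2) *
      ‖charFun ((nu g s).map (Nat.cast : ℕ → ℝ)) t‖ ^ 2 ≤ (1 - s) ^ 2 :=
    (mul_le_mul_of_nonneg_right h6 (by positivity)).trans h7
  rw [← div_le_one ha] at h8
  refine le_trans (le_of_eq ?_) h8
  have ha' : 1 - s ≠ 0 := by linarith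
  field_simp

/-- At frequency `1 - s` the characteristic function is bounded away from `1`. -/
lemma exists_norm_charFun_nu_le (hg : ∀ k, 0 ≤ g k) (h0 : 0 < g 0) {D : ℝ}
    (h : ∀ m, G g (2 * m + 1) ≤ D * G g m) :
    ∃ κ : ℝ, 0 < κ ∧ ∀ s : ℝ, 1 / 2 ≤ s → s < 1 →
      κ ≤ 1 - ‖charFun ((nu g s).map (Nat.cast : ℕ → ℝ)) (1 - s)‖ := by
  have hc : (0 : ℝ) < 2 / Real.pi ^ 2 := by positivity
  have hq : 1 / (1 + 2 / Real.pi ^ 2) < 1 := by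
    rw [div_lt_one (by positivity)]; linarith
  refine ⟨1 - √(1 / (1 + 2 / Real.pi ^ 2)), ?_, fun s hs0 hs1 => ?_⟩
  · have := Real.sqrt_lt_sqrt (by positivity) hq
    rw [Real.sqrt_one] at this
    linarith
  · have ha : 0 < 1 - s := by linarith
    have h1 := sq_norm_charFun_nu_le hg h0 h hs0 hs1 (t := 1 - s) (by
      rw [abs_of_pos ha]; linarith [Real.pi_gt_three])
    rw [div_self (by positivity), mul_one] at h1
    have := Real.le_sqrt_of_sq_le h1
    linarith

lemma continuousOn_Q (hg : ∀ k, 0 ≤ g k) (h0 : 0 < g 0) {D : ℝ}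
    (h : ∀ m, G g (2 * m + 1) ≤ D * G g m) (n : ℕ) {r : ℝ} (hr0 : 0 ≤ r) (hr1 : r < 1) :
    ContinuousOn (Q g n) (Set.Icc 0 r) := by
  refine continuousOn_tsum (fun k => by fun_prop) (summable_pow_mul_G hg h0 h n hr0 hr1) ?_
  intro k s hs
  have := G_pos hg h0 k
  have h1 := hs.1
  rw [Real.norm_of_nonneg (by positivity)]
  gcongr
  exact hs.2

/-- Intermediate value theorem on `[1/2, 1-a]`. At `s = 1-a` the mean is at least `κ/a`, since the
characteristic function at frequency `a` stays `κ` below `1`; `a` is chosen so that `κ/a ≥ K`. -/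
lemma exists_mean_eq (hg : ∀ k, 0 ≤ g k) (h0 : 0 < g 0) {D : ℝ}
    (h : ∀ m, G g (2 * m + 1) ≤ D * G g m) {K : ℝ} (hK0 : 0 < K)
    (hK : ∫ k, (k : ℝ) ∂(nu g (1 / 2)) ≤ K) :
    ∃ s ∈ Set.Ioo (0 : ℝ) 1, ∫ k, (k : ℝ) ∂(nu g s) = K := by
  obtain ⟨κ, hκ, hκ'⟩ := exists_norm_charFun_nu_le hg h0 h
  have hmean : ∀ s : ℝ, 0 ≤ s → s < 1 → ∫ k, (k : ℝ) ∂(nu g s) = Q g 1 s / Q g 0 s :=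
    fun s hs0 hs1 => by simpa using integral_pow_nu hg h0 h hs0 hs1 1
  set a := min (1 / 2) (κ / K) with ha
  have ha0 : 0 < a := by positivity
  have ha1 : a ≤ 1 / 2 := min_le_left _ _
  have ha2 : a * K ≤ κ := by rw [← le_div_iff₀ hK0]; exact min_le_right _ _
  have hs1 : 1 - a < 1 := by linarith
  have hlow : K ≤ ∫ k, (k : ℝ) ∂(nu g (1 - a)) := by
    have := isProbabilityMeasure_nu hg h0 h (s := 1 - a) (by linarith) hs1
    have h1 := hκ' (1 - a) (by linarith) hs1
    have h2 := one_sub_norm_charFun_le_mean (μ := nu g (1 - a))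
      (by simpa using integrable_pow_nu hg h0 h (s := 1 - a) (by linarith) hs1 1) (1 - (1 - a))
    rw [show |1 - (1 - a)| = a by rw [sub_sub_cancel, abs_of_pos ha0]] at h2
    exact le_of_mul_le_mul_left (ha2.trans (h1.trans h2)) ha0
  rw [hmean _ (by norm_num) (by norm_num)] at hK
  rw [hmean _ (by linarith) hs1] at hlow
  have hsub : Set.Icc (1 / 2) (1 - a) ⊆ Set.Icc 0 (1 - a) := Set.Icc_subset_Icc_left (by norm_num)
  have hcont : ContinuousOn (fun s => Q g 1 s / Q g 0 s) (Set.Icc (1 / 2) (1 - a)) :=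
    ((continuousOn_Q hg h0 h 1 (by linarith) hs1).mono hsub).div
      ((continuousOn_Q hg h0 h 0 (by linarith) hs1).mono hsub) fun s hs =>
      (Q_zero_pos hg h0 h (by linarith [hs.1]) (by linarith [hs.2])).ne'
  obtain ⟨s, hs, hsK⟩ := intermediate_value_Icc (by linarith) hcont ⟨hK, hlow⟩
  refine ⟨s, ⟨by linarith [hs.1], by linarith [hs.2]⟩, ?_⟩
  rw [hmean s (by linarith [hs.1]) (by linarith [hs.2])]
  exact hsK

end ExponentialFamily

/-! ### Uniform regularity, and the location of `s*` -/

/-- The regularity of a probability measure on `ℕ` that enters the local limit theorem. -/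
structure IsRegular (κ c C : ℝ) (μ : Measure ℕ) : Prop where
  prob : IsProbabilityMeasure μ
  integrable : Integrable (fun k : ℕ => (k : ℝ) ^ 3) μ
  le_variance : κ ≤ variance (fun k : ℕ => (k : ℝ)) μ
  mean_le : ∫ k, (k : ℝ) ∂μ ≤ C * √(variance (fun k : ℕ => (k : ℝ)) μ)
  moment_le : ∫ k, (k : ℝ) ^ 3 ∂μ ≤ C * √(variance (fun k : ℕ => (k : ℝ)) μ) ^ 3
  charFun_le : ∀ t : ℝ, |t| ≤ Real.pi → ‖charFun (μ.map (Nat.cast : ℕ → ℝ)) t‖ ^ 2 ≤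
    1 / (1 + c * (variance (fun k : ℕ => (k : ℝ)) μ * t ^ 2))

/-- The measures `ν_s`, `1 / 2 ≤ s < 1`, are uniformly regular. -/
lemma exists_isRegular_nu {g : ℕ → ℝ} (hg : ∀ k, 0 ≤ g k) (h0 : 0 < g 0) {D : ℝ}
    (h : ∀ m, G g (2 * m + 1) ≤ D * G g m) (hD : 0 < D) :
    ∃ κ c C : ℝ, 0 < κ ∧ 0 < c ∧ 0 < C ∧
      ∀ s : ℝ, 1 / 2 ≤ s → s < 1 → IsRegular κ c C (nu g s) := by
  obtain ⟨κ, hκ, hκ'⟩ := exists_norm_charFun_nu_le hg h0 h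
  have hk : 0 < √(2 * κ) := by positivity
  -- The numbers `4`, `16`, `96` are `n! 2^(n+1)` for `n = 1, 2, 3`, from the moment bounds. The
  -- third constant is a sum so that it serves for both the mean and the third moment.
  refine ⟨2 * κ, 2 / Real.pi ^ 2 / (16 * D), 4 * D / √(2 * κ) + 96 * D / √(2 * κ) ^ 3,
    by positivity, by positivity, by positivity, fun s hs0 hs1 => ?_⟩
  have hs : 0 ≤ s := by linarith
  have ha : 0 < 1 - s := by linarith
  have := isProbabilityMeasure_nu hg h0 h hs hs1
  have hint := fun n => integrable_pow_nu hg h0 h hs hs1 n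
  have hmom := fun n => integral_pow_nu_le hg h0 h hs hs1 n
  set v := variance (fun k : ℕ => (k : ℝ)) (nu g s) with hv
  have hlow : 2 * κ / (1 - s) ^ 2 ≤ v := by
    rw [div_le_iff₀ (by positivity), mul_comm v]
    refine le_trans ?_ (two_mul_one_sub_norm_charFun_le_variance (hint 2) (1 - s))
    linarith [hκ' s hs0 hs1]
  have hupp : v ≤ 16 * D / (1 - s) ^ 2 := by
    refine (variance_le_expectation_sq (by fun_prop)).trans ?_
    refine le_trans (le_of_eq ?_) ((hmom 2).trans_eq (by norm_num [Nat.factorial]))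
    rfl
  have hv0 : 0 ≤ v := variance_nonneg _ _
  have hinv : √(2 * κ) / (1 - s) ≤ √v := by
    refine Real.le_sqrt_of_sq_le ?_
    rw [div_pow, Real.sq_sqrt (by positivity)]
    exact hlow
  have hinv' : 1 / (1 - s) ≤ √v / √(2 * κ) := by
    rw [le_div_iff₀ hk, div_mul_eq_mul_div, one_mul]
    exact hinv
  refine ⟨inferInstance, hint 3, ?_, ?_, ?_, fun t ht => ?_⟩
  · refine le_trans ?_ hlow
    rw [le_div_iff₀ (by positivity)]
    have : (1 - s) ^ 2 ≤ 1 := pow_le_one₀ ha.le (by linarith)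
    nlinarith
  · have h1 := hmom 1
    norm_num at h1
    have h2 : 0 ≤ 96 * D / √(2 * κ) ^ 3 * √v := by positivity
    calc _ ≤ 4 * D / (1 - s) := h1
      _ = 4 * D * (1 / (1 - s)) := by ring
      _ ≤ 4 * D * (√v / √(2 * κ)) := by gcongr
      _ ≤ 4 * D * (√v / √(2 * κ)) + 96 * D / √(2 * κ) ^ 3 * √v := by linarith
      _ = _ := by ring
  · have h1 := hmom 3
    norm_num [Nat.factorial] at h1
    have h2 : 0 ≤ 4 * D / √(2 * κ) * √v ^ 3 := by positivity
    calc _ ≤ 96 * D / (1 - s) ^ 3 := h1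
      _ = 96 * D * (1 / (1 - s)) ^ 3 := by field_simp
      _ ≤ 96 * D * (√v / √(2 * κ)) ^ 3 := by gcongr
      _ ≤ 96 * D * (√v / √(2 * κ)) ^ 3 + 4 * D / √(2 * κ) * √v ^ 3 := by linarith
      _ = _ := by rw [div_pow]; ring
  · refine (sq_norm_charFun_nu_le hg h0 h hs0 hs1 ht).trans ?_
    refine one_div_le_one_div_of_le (by positivity) ?_
    have h1 : v * t ^ 2 ≤ 16 * D / (1 - s) ^ 2 * t ^ 2 := by gcongr
    have h2 : 2 / Real.pi ^ 2 / (16 * D) * (v * t ^ 2) ≤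
        2 / Real.pi ^ 2 / (16 * D) * (16 * D / (1 - s) ^ 2 * t ^ 2) := by gcongr
    have h3 : 2 / Real.pi ^ 2 / (16 * D) * (16 * D / (1 - s) ^ 2 * t ^ 2) =
      2 / Real.pi ^ 2 * (t ^ 2 / (1 - s) ^ 2) := by field_simp
    linarith

/-- The mean of `ν_s` is at most `4D/(1-s)`, hence at most `8D` when `s ≤ 1/2`. So for `K > 8D` a
solution exists and every solution exceeds `1/2`; uniqueness plays no role. -/
lemma sStar_mem {g : ℕ → ℝ} (hg : ∀ k, 0 ≤ g k) (h0 : 0 < g 0) {D : ℝ}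
    (h : ∀ m, G g (2 * m + 1) ≤ D * G g m) (hD : 0 < D) {K : ℝ} (hK : 8 * D < K) :
    1 / 2 ≤ sStar g K ∧ sStar g K < 1 ∧ ∫ k, (k : ℝ) ∂(nu g (sStar g K)) = K := by
  have hle : ∀ s : ℝ, 0 ≤ s → s < 1 → ∫ k, (k : ℝ) ∂(nu g s) ≤ 4 * D / (1 - s) := by
    intro s hs0 hs1
    have h1 := integral_pow_nu_le hg h0 h hs0 hs1 1
    norm_num at h1
    exact h1
  have hex : ∃ s, s ∈ Set.Ioo (0 : ℝ) 1 ∧ ∫ k, (k : ℝ) ∂(nu g s) = K := by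
    refine exists_mean_eq hg h0 h (by linarith) ?_
    have := hle (1 / 2) (by norm_num) (by norm_num)
    norm_num at this ⊢
    linarith
  obtain ⟨h1, h2⟩ : sStar g K ∈ Set.Ioo (0 : ℝ) 1 ∧ ∫ k, (k : ℝ) ∂(nu g (sStar g K)) = K :=
    Classical.epsilon_spec hex
  refine ⟨?_, h1.2, h2⟩
  by_contra! hlt
  have h3 := hle _ h1.1.le h1.2
  have h4 : 4 * D / (1 - sStar g K) ≤ 8 * D := by
    rw [div_le_iff₀ (by linarith)]
    nlinarith
  linarith

end MoneyExchange

namespace MoneyExchange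

/-! ### Fourier inversion and the error integral -/

section Inversion

lemma integral_cexp_int_mul (m : ℤ) :
    ∫ t in (-Real.pi)..Real.pi, Complex.exp ((t * m : ℝ) * Complex.I) =
      if m = 0 then ((2 * Real.pi : ℝ) : ℂ) else 0 := by
  split_ifs with hm
  · subst hm
    simp
    ring
  · have hc : (m : ℂ) * Complex.I ≠ 0 := mul_ne_zero (by exact_mod_cast hm) Complex.I_ne_zero
    have h1 : ∀ t : ℝ, Complex.exp ((t * m : ℝ) * Complex.I) =
        Complex.exp ((m : ℂ) * Complex.I * t) := fun t => by
      push_cast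
      ring_nf
    simp_rw [h1]
    rw [integral_exp_mul_complex hc, div_eq_zero_iff]
    left
    rw [sub_eq_zero, Complex.exp_eq_exp_iff_exists_int]
    refine ⟨m, ?_⟩
    push_cast
    ring

/-- Fourier inversion for probability measures on the nonnegative integers. -/
lemma two_pi_mul_measureReal_singleton (ν : Measure ℕ) [IsProbabilityMeasure ν] (L : ℕ) :
    ((2 * Real.pi * ν.real {L} : ℝ) : ℂ) = ∫ t in (-Real.pi)..Real.pi,
      Complex.exp ((-(t * L) : ℝ) * Complex.I) * charFun (ν.map (Nat.cast : ℕ → ℝ)) t := by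
  have h1 : ∀ t : ℝ, Complex.exp ((-(t * L) : ℝ) * Complex.I) *
      charFun (ν.map (Nat.cast : ℕ → ℝ)) t =
      ∫ k : ℕ, Complex.exp ((t * ((k : ℝ) - L) : ℝ) * Complex.I) ∂ν :=
    fun t => cexp_mul_charFun ν t L
  simp_rw [h1]
  rw [intervalIntegral_integral_swap]
  · have h2 : ∀ k : ℕ, ∫ t in (-Real.pi)..Real.pi,
        Complex.exp ((t * ((k : ℝ) - L) : ℝ) * Complex.I) =
        Set.indicator {L} (fun _ => ((2 * Real.pi : ℝ) : ℂ)) k := by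
      intro k
      have h3 := integral_cexp_int_mul ((k : ℤ) - L)
      push_cast at h3 ⊢
      rw [h3]
      by_cases hk : k = L
      · simp [hk]
      · have : (k : ℤ) - L ≠ 0 := by omega
        simp [hk, this]
    simp_rw [h2]
    rw [integral_indicator (MeasurableSet.singleton L), setIntegral_const]
    rw [Complex.real_smul]
    push_cast
    ring
  · have : IsFiniteMeasure (volume.restrict (Set.uIoc (-Real.pi) Real.pi)) :=
      ⟨by simp [Set.uIoc]⟩
    refine Integrable.of_bound (C := 1) ?_ (ae_of_all _ fun p => ?_)
    · refine Measurable.aestronglyMeasurable ?_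
      simp only [Function.uncurry_def]
      fun_prop
    · simp only [Function.uncurry_def, Complex.norm_exp_ofReal_mul_I, le_refl]

/-- The difference of the rescaled centered characteristic function, cut off to the period, and
the characteristic function of the standard normal law. -/
noncomputable def fourierError (ψ : ℝ → ℂ) (τ m u : ℝ) : ℂ :=
  (Set.Ioc (-(Real.pi * τ)) (Real.pi * τ)).indicator
    (fun u => Complex.exp ((-(u / τ * m) : ℝ) * Complex.I) * ψ (u / τ)) u -
  Complex.exp (-(1 / 2 : ℂ) * (u : ℂ) ^ 2)

lemma mul_measureReal_singleton (ν : Measure ℕ) [IsProbabilityMeasure ν] {τ : ℝ} (hτ : 0 < τ)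
    (L : ℕ) :
    ((2 * Real.pi * (τ * ν.real {L}) : ℝ) : ℂ) =
      ∫ u, (Set.Ioc (-(Real.pi * τ)) (Real.pi * τ)).indicator
        (fun u => Complex.exp ((-(u / τ * L) : ℝ) * Complex.I) *
          charFun (ν.map (Nat.cast : ℕ → ℝ)) (u / τ)) u := by
  have h1 := intervalIntegral.integral_comp_div (a := -(Real.pi * τ)) (b := Real.pi * τ)
    (fun t : ℝ => Complex.exp ((-(t * L) : ℝ) * Complex.I) *
      charFun (ν.map (Nat.cast : ℕ → ℝ)) t) hτ.ne'
  rw [neg_div, mul_div_assoc, div_self hτ.ne', mul_one, ← two_pi_mul_measureReal_singleton,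
    intervalIntegral.integral_of_le (by nlinarith [Real.pi_pos])] at h1
  rw [integral_indicator measurableSet_Ioc, h1, Complex.real_smul]
  push_cast
  ring

lemma two_pi_mul_gaussian (x : ℝ) :
    ((2 * Real.pi * (1 / √(2 * Real.pi) * Real.exp (-(x ^ 2) / 2)) : ℝ) : ℂ) =
      ∫ u : ℝ, Complex.exp ((-(u * x) : ℝ) * Complex.I) *
        Complex.exp (-(1 / 2 : ℂ) * (u : ℂ) ^ 2) := by
  have h := fourierIntegral_gaussian (b := 1 / 2) (by norm_num) (-(x : ℂ))
  have h1 : ∀ u : ℝ, Complex.exp ((-(u * x) : ℝ) * Complex.I) =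
      Complex.exp (Complex.I * -(x : ℂ) * u) := fun u => by
    push_cast
    ring_nf
  simp_rw [h1]
  rw [h]
  have h2 : ((Real.pi : ℂ) / (1 / 2)) ^ (1 / 2 : ℂ) = ((√(2 * Real.pi) : ℝ) : ℂ) := by
    rw [Real.sqrt_eq_rpow, Complex.ofReal_cpow (by positivity)]
    push_cast
    congr 1
    ring
  have h3 : 2 * Real.pi * (1 / √(2 * Real.pi) * Real.exp (-(x ^ 2) / 2)) =
      √(2 * Real.pi) * Real.exp (-(x ^ 2) / 2) := by
    have : √(2 * Real.pi) ≠ 0 := by positivity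
    have h4 : √(2 * Real.pi) * √(2 * Real.pi) = 2 * Real.pi :=
      Real.mul_self_sqrt (by positivity)
    field_simp
    linarith
  rw [h2, h3]
  push_cast
  congr 2
  ring

lemma integrable_cexp_gaussian :
    Integrable fun u : ℝ => Complex.exp (-(1 / 2 : ℂ) * (u : ℂ) ^ 2) :=
  integrable_cexp_neg_mul_sq (by norm_num)

lemma measurable_charFun_map_natCast (ν : Measure ℕ) [IsProbabilityMeasure ν] :
    Measurable (charFun (ν.map (Nat.cast : ℕ → ℝ))) := by
  have : IsProbabilityMeasure (ν.map (Nat.cast : ℕ → ℝ)) :=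
    Measure.isProbabilityMeasure_map (by fun_prop)
  exact measurable_charFun

/-- The source of uniformity in `L`: after subtracting the two inversion formulas, `L` survives only
in the unimodular factor `e^{-iu(L-m)/τ}`, which disappears under the norm. -/
lemma abs_sub_gaussian_le (ν : Measure ℕ) [IsProbabilityMeasure ν] {τ : ℝ} (hτ : 0 < τ) (m : ℝ)
    (L : ℕ) :
    |τ * ν.real {L} - 1 / √(2 * Real.pi) * Real.exp (-((((L : ℝ) - m) / τ) ^ 2) / 2)| ≤
      1 / (2 * Real.pi) * ∫ u, ‖fourierError (charFun (ν.map (Nat.cast : ℕ → ℝ))) τ m u‖ := by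
  have hprob : IsProbabilityMeasure (ν.map (Nat.cast : ℕ → ℝ)) :=
    Measure.isProbabilityMeasure_map (by fun_prop)
  have hmeas := measurable_charFun_map_natCast ν
  have hI1 : Integrable ((Set.Ioc (-(Real.pi * τ)) (Real.pi * τ)).indicator
        (fun u => Complex.exp ((-(u / τ * L) : ℝ) * Complex.I) *
          charFun (ν.map (Nat.cast : ℕ → ℝ)) (u / τ))) := by
    rw [integrable_indicator_iff measurableSet_Ioc]
    refine Measure.integrableOn_of_bounded (M := 1) (by simp) ?_ (ae_of_all _ fun u => ?_)
    · exact (Measurable.mul (by fun_prop) (hmeas.comp (by fun_prop))).aestronglyMeasurable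
    · rw [norm_mul, Complex.norm_exp_ofReal_mul_I, one_mul]
      exact norm_charFun_le_one _
  have hI2 : Integrable fun u : ℝ => Complex.exp ((-(u * ((L - m) / τ)) : ℝ) * Complex.I) *
        Complex.exp (-(1 / 2 : ℂ) * (u : ℂ) ^ 2) := by
    refine integrable_cexp_gaussian.bdd_mul (c := 1) (by fun_prop) (ae_of_all _ fun u => ?_)
    rw [Complex.norm_exp_ofReal_mul_I]
  have h1 := mul_measureReal_singleton ν hτ L
  have h2 := two_pi_mul_gaussian (((L : ℝ) - m) / τ)
  have h3 : ((2 * Real.pi * (τ * ν.real {L} -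
      1 / √(2 * Real.pi) * Real.exp (-((((L : ℝ) - m) / τ) ^ 2) / 2)) : ℝ) : ℂ) =
      ∫ u, Complex.exp ((-(u * ((L - m) / τ)) : ℝ) * Complex.I) *
        fourierError (charFun (ν.map (Nat.cast : ℕ → ℝ))) τ m u := by
    rw [mul_sub, Complex.ofReal_sub, h1, h2, ← integral_sub hI1 hI2]
    congr 1
    ext u
    rw [fourierError, mul_sub]
    congr 1
    by_cases hu : u ∈ Set.Ioc (-(Real.pi * τ)) (Real.pi * τ)
    · rw [Set.indicator_of_mem hu, Set.indicator_of_mem hu, ← mul_assoc, ← Complex.exp_add]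
      congr 2
      push_cast
      ring
    · rw [Set.indicator_of_notMem hu, Set.indicator_of_notMem hu, mul_zero]
  have h4 := congrArg norm h3
  rw [Complex.norm_real, Real.norm_eq_abs, abs_mul, abs_of_pos Real.two_pi_pos] at h4
  rw [one_div_mul_eq_div (2 * Real.pi), le_div_iff₀ Real.two_pi_pos, mul_comm, h4]
  refine (norm_integral_le_integral_norm _).trans_eq ?_
  congr 1
  ext u
  rw [norm_mul, Complex.norm_exp_ofReal_mul_I, one_mul]

end Inversion

/-! ### Pointwise convergence and domination -/

section LocalLimit

lemma tendsto_one_add_pow_sub (j : ℕ) {z : ℕ → ℂ} {t : ℂ}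
    (h : Tendsto (fun N : ℕ => ((N - j : ℕ) : ℂ) * z N) atTop (𝓝 t)) :
    Tendsto (fun N : ℕ => (1 + z N) ^ (N - j)) atTop (𝓝 (Complex.exp t)) := by
  have h1 : Tendsto (fun k : ℕ => (k : ℂ) * z (k + j)) atTop (𝓝 t) := by
    simpa [Function.comp_def] using h.comp (tendsto_add_atTop_nat j)
  have h2 := (Complex.tendsto_one_add_pow_exp_of_tendsto h1).comp (tendsto_sub_atTop_nat j)
  refine h2.congr' ?_
  filter_upwards [eventually_ge_atTop j] with N hN
  simp [Nat.sub_add_cancel hN]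

/-- Bernoulli's inequality for the exponent `⌊n/2⌋`, which is at least `(M-1)/2 ≥ M/4` because `M ≥
2`. The resulting bound does not depend on `n` or `M` and is integrable when `y = c u^2`. -/
lemma pow_le_inv_of_sq_le {x y M : ℝ} (hx0 : 0 ≤ x) (hx1 : x ≤ 1) (hy : 0 ≤ y) (hM : 2 ≤ M)
    (h : x ^ 2 ≤ 1 / (1 + y / M)) {n : ℕ} (hn : M ≤ n) : x ^ n ≤ (1 + y / 4)⁻¹ := by
  have hM0 : 0 < M := by linarith
  have hq : M / 4 ≤ ((n / 2 : ℕ) : ℝ) := by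
    have : n ≤ 2 * (n / 2) + 1 := by omega
    have : (n : ℝ) ≤ 2 * ((n / 2 : ℕ) : ℝ) + 1 := by exact_mod_cast this
    linarith
  have hb : 1 + y / 4 ≤ (1 + y / M) ^ (n / 2) := by
    refine le_trans ?_ (one_add_mul_le_pow (by have : 0 ≤ y / M := by positivity
                                               linarith) (n / 2))
    have h1 : M / 4 * (y / M) ≤ ((n / 2 : ℕ) : ℝ) * (y / M) := by gcongr
    have h2 : M / 4 * (y / M) = y / 4 := by field_simp
    linarith
  calc x ^ n ≤ x ^ (2 * (n / 2)) := pow_le_pow_of_le_one hx0 hx1 (by omega)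
    _ = (x ^ 2) ^ (n / 2) := pow_mul _ _ _
    _ ≤ (1 / (1 + y / M)) ^ (n / 2) := by gcongr
    _ = ((1 + y / M) ^ (n / 2))⁻¹ := by rw [one_div, inv_pow]
    _ ≤ (1 + y / 4)⁻¹ := by gcongr

variable {κ c C : ℝ} {μ : Measure ℕ}

lemma IsRegular.norm_fourierError_le (h : IsRegular κ c C μ) (hκ : 0 < κ) (hc : 0 < c) {M : ℝ}
    (hM : 2 ≤ M) {n : ℕ} (hn : M ≤ n) (m u : ℝ) :
    ‖fourierError (fun t => charFun (μ.map (Nat.cast : ℕ → ℝ)) t ^ n)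
        √(variance (fun k : ℕ => (k : ℝ)) μ * M) m u‖ ≤
      (1 + c * u ^ 2 / 4)⁻¹ + ‖Complex.exp (-(1 / 2 : ℂ) * (u : ℂ) ^ 2)‖ := by
  have := h.prob
  have hprob : IsProbabilityMeasure (μ.map (Nat.cast : ℕ → ℝ)) :=
    Measure.isProbabilityMeasure_map (by fun_prop)
  have hv : 0 < variance (fun k : ℕ => (k : ℝ)) μ := hκ.trans_le h.le_variance
  have hM0 : 0 < M := by linarith
  set τ := √(variance (fun k : ℕ => (k : ℝ)) μ * M) with hτ
  have hτ0 : 0 < τ := by positivity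
  have hτ2 : τ ^ 2 = variance (fun k : ℕ => (k : ℝ)) μ * M := Real.sq_sqrt (by positivity)
  refine (norm_sub_le _ _).trans (add_le_add ?_ le_rfl)
  by_cases hu : u ∈ Set.Ioc (-(Real.pi * τ)) (Real.pi * τ)
  · rw [Set.indicator_of_mem hu, norm_mul, Complex.norm_exp_ofReal_mul_I, one_mul, norm_pow]
    refine pow_le_inv_of_sq_le (norm_nonneg _) (norm_charFun_le_one _) (by positivity) hM ?_ hn
    have h1 : |u / τ| ≤ Real.pi := by
      rw [abs_div, abs_of_pos hτ0, div_le_iff₀ hτ0]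
      exact abs_le.2 ⟨hu.1.le, hu.2⟩
    refine (h.charFun_le _ h1).trans_eq ?_
    rw [div_pow, hτ2]
    congr 2
    field_simp
  · rw [Set.indicator_of_notMem hu, norm_zero]
    positivity

lemma integrable_inv_add_gaussian (hc : 0 < c) :
    Integrable fun u : ℝ =>
      (1 + c * u ^ 2 / 4)⁻¹ + ‖Complex.exp (-(1 / 2 : ℂ) * (u : ℂ) ^ 2)‖ := by
  refine Integrable.add ?_ integrable_cexp_gaussian.norm
  have h1 := integrable_inv_one_add_sq.comp_mul_left' (R := √(c / 4)) (by positivity)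
  refine h1.congr (ae_of_all _ fun u => ?_)
  simp only [mul_pow]
  rw [Real.sq_sqrt (by positivity)]
  ring_nf

lemma tendsto_natCast_sub_atTop (d : ℕ) : Tendsto (fun N : ℕ => (N : ℝ) - d) atTop atTop :=
  tendsto_atTop_add_const_right _ _ tendsto_natCast_atTop_atTop

lemma tendsto_natCast_tsub_div_sub (i d : ℕ) :
    Tendsto (fun N : ℕ => ((N - i : ℕ) : ℝ) / ((N : ℝ) - d)) atTop (𝓝 1) := by
  have h1 : Tendsto (fun N : ℕ => 1 + ((d : ℝ) - i) / ((N : ℝ) - d)) atTop (𝓝 (1 + 0)) :=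
    tendsto_const_nhds.add (tendsto_const_nhds.div_atTop (tendsto_natCast_sub_atTop d))
  rw [add_zero] at h1
  refine h1.congr' ?_
  filter_upwards [eventually_ge_atTop i, (tendsto_natCast_sub_atTop d).eventually_gt_atTop 0]
    with N hN hN'
  rw [Nat.cast_sub hN]
  field_simp
  ring

/-- Pointwise convergence of the rescaled characteristic functions. -/
lemma tendsto_fourierError (hκ : 0 < κ) {μ : ℕ → Measure ℕ}
    (h : ∀ᶠ N in atTop, IsRegular κ c C (μ N)) {i d : ℕ} (u : ℝ) :
    Tendsto (fun N : ℕ => fourierError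
      (fun t => charFun ((μ N).map (Nat.cast : ℕ → ℝ)) t ^ (N - i))
      √(variance (fun k : ℕ => (k : ℝ)) (μ N) * ((N : ℝ) - d))
      (((N : ℝ) - d) * ∫ k, (k : ℝ) ∂(μ N)) u) atTop (𝓝 0) := by
  set v : ℕ → ℝ := fun N => variance (fun k : ℕ => (k : ℝ)) (μ N) with hv
  set b : ℕ → ℝ := fun N => ∫ k, (k : ℝ) ∂(μ N) with hb
  set M : ℕ → ℝ := fun N => (N : ℝ) - d with hM
  set τ : ℕ → ℝ := fun N => √(v N * M N) with hτ
  have hMt : Tendsto M atTop atTop := tendsto_natCast_sub_atTop d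
  have hM0 : ∀ᶠ N in atTop, 0 < M N := hMt.eventually_gt_atTop 0
  have hsq : Tendsto (fun N => √(M N)) atTop atTop := Real.tendsto_sqrt_atTop.comp hMt
  have hinv : Tendsto (fun N => (√(M N))⁻¹) atTop (𝓝 0) := tendsto_inv_atTop_zero.comp hsq
  have hτt : Tendsto τ atTop atTop := by
    refine tendsto_atTop_mono' _ ?_ (hsq.const_mul_atTop (show 0 < √κ by positivity))
    filter_upwards [h, hM0] with N hN hMN
    rw [← Real.sqrt_mul hκ.le]
    exact Real.sqrt_le_sqrt (mul_le_mul_of_nonneg_right hN.le_variance hMN.le)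
  have hC : ∀ᶠ N in atTop, 0 < v N ∧ 0 ≤ b N ∧ b N ≤ C * √(v N) ∧
      ∫ k, (k : ℝ) ^ 3 ∂(μ N) ≤ C * √(v N) ^ 3 := by
    filter_upwards [h] with N hN
    exact ⟨hκ.trans_le hN.le_variance, integral_nonneg fun k => Nat.cast_nonneg k, hN.mean_le,
      hN.moment_le⟩
  -- There are `N - i` factors, while scale and centering use `N - d`. The centered factor `w N`
  -- carries the Gaussian limit; the mismatch leaves the phase `(u/τ) b (d-i)`, which vanishes
  -- because `b ≤ C √v` and `τ = √v √M`.
  set w : ℕ → ℂ := fun N => Complex.exp ((-(u / τ N * b N) : ℝ) * Complex.I) *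
    charFun ((μ N).map (Nat.cast : ℕ → ℝ)) (u / τ N) with hw
  have hpow : Tendsto (fun N : ℕ => w N ^ (N - i)) atTop
      (𝓝 (Complex.exp (-(1 / 2 : ℂ) * (u : ℂ) ^ 2))) := by
    have key : Tendsto (fun N : ℕ => ((N - i : ℕ) : ℂ) * (w N - 1)) atTop
        (𝓝 (-(1 / 2 : ℂ) * (u : ℂ) ^ 2)) := by
      have h1 : Tendsto (fun N : ℕ => ((((N - i : ℕ) : ℝ) / M N * (-(1 / 2) * u ^ 2) : ℝ) : ℂ))
          atTop (𝓝 (((1 * (-(1 / 2) * u ^ 2) : ℝ)) : ℂ)) :=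
        (Complex.continuous_ofReal.tendsto _).comp
          ((tendsto_natCast_tsub_div_sub i d).mul_const _)
      have h2 : Tendsto (fun N : ℕ => ((N - i : ℕ) : ℂ) * (w N - 1) -
          ((((N - i : ℕ) : ℝ) / M N * (-(1 / 2) * u ^ 2) : ℝ) : ℂ)) atTop (𝓝 0) := by
        -- The cubic Taylor error, summed over the factors: `(N-i) |u/τ|^3 v^{3/2}` is of order
        -- `M^{-1/2}`, whatever the size of `v`.
        have h3 : Tendsto (fun N : ℕ => ((N - i : ℕ) : ℝ) / M N * (√(M N))⁻¹ *
            (4 * |u| ^ 3 * (C + C ^ 3))) atTop (𝓝 (1 * 0 * (4 * |u| ^ 3 * (C + C ^ 3)))) :=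
          ((tendsto_natCast_tsub_div_sub i d).mul hinv).mul_const _
        rw [mul_zero, zero_mul] at h3
        refine squeeze_zero_norm' ?_ h3
        filter_upwards [h, hC, hM0] with N hN hCN hMN
        obtain ⟨hv0, hb0, hb1, h31⟩ := hCN
        have := hN.prob
        have hτ0 : 0 < τ N := Real.sqrt_pos.2 (mul_pos hv0 hMN)
        have hτ2 : τ N ^ 2 = v N * M N := Real.sq_sqrt (mul_pos hv0 hMN).le
        have hτs : τ N = √(v N) * √(M N) := Real.sqrt_mul hv0.le _
        have hM2 : √(M N) ^ 2 = M N := Real.sq_sqrt hMN.le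
        have hsv : 0 < √(v N) := Real.sqrt_pos.2 hv0
        have hsM : 0 < √(M N) := Real.sqrt_pos.2 hMN
        have h4 := norm_charFun_sub_le hN.integrable (m := b N) rfl (u / τ N)
        have h5 : (u / τ N) ^ 2 / 2 * v N = 1 / M N * (1 / 2 * u ^ 2) := by
          rw [div_pow, hτ2]
          field_simp
        change ‖w N - ((1 - (u / τ N) ^ 2 / 2 * v N : ℝ) : ℂ)‖ ≤ _ at h4
        rw [h5] at h4
        have h6 : ((N - i : ℕ) : ℂ) * (w N - 1) -
            ((((N - i : ℕ) : ℝ) / M N * (-(1 / 2) * u ^ 2) : ℝ) : ℂ) =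
            ((N - i : ℕ) : ℂ) * (w N - ((1 - 1 / M N * (1 / 2 * u ^ 2) : ℝ) : ℂ)) := by
          push_cast
          ring
        rw [h6, norm_mul, Complex.norm_natCast]
        have h7 : ∫ k, (k : ℝ) ^ 3 ∂(μ N) + b N ^ 3 ≤ (C + C ^ 3) * √(v N) ^ 3 := by
          have : b N ^ 3 ≤ (C * √(v N)) ^ 3 := pow_le_pow_left₀ hb0 hb1 3
          rw [mul_pow] at this
          linarith
        calc _ ≤ ((N - i : ℕ) : ℝ) * (4 * |u / τ N| ^ 3 * ((C + C ^ 3) * √(v N) ^ 3)) := by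
              refine mul_le_mul_of_nonneg_left (h4.trans ?_) (Nat.cast_nonneg _)
              exact mul_le_mul_of_nonneg_left h7 (by positivity)
          _ = _ := by
              rw [abs_div, abs_of_pos hτ0, div_pow, hτs, mul_pow,
                show √(M N) ^ 3 = M N * √(M N) by rw [pow_succ, hM2]]
              field_simp
      have h8 := h2.add h1
      simp only [sub_add_cancel, zero_add, one_mul] at h8
      refine h8.trans (le_of_eq ?_)
      push_cast
      rfl
    have h9 := tendsto_one_add_pow_sub i key
    simpa only [add_sub_cancel] using h9
  have hphase : Tendsto (fun N : ℕ =>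
      Complex.exp ((u / τ N * b N * ((d : ℝ) - i) : ℝ) * Complex.I)) atTop (𝓝 1) := by
    have h1 : Tendsto (fun N : ℕ => u / τ N * b N * ((d : ℝ) - i)) atTop (𝓝 0) := by
      have h2 : Tendsto (fun N : ℕ => (√(M N))⁻¹ * (|u| * C * |(d : ℝ) - i|)) atTop
          (𝓝 (0 * (|u| * C * |(d : ℝ) - i|))) := hinv.mul_const _
      rw [zero_mul] at h2
      refine squeeze_zero_norm' ?_ h2
      filter_upwards [hC, hM0] with N hCN hMN
      obtain ⟨hv0, hb0, hb1, -⟩ := hCN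
      have hτs : τ N = √(v N) * √(M N) := Real.sqrt_mul hv0.le _
      have hsv : 0 < √(v N) := Real.sqrt_pos.2 hv0
      have hsM : 0 < √(M N) := Real.sqrt_pos.2 hMN
      rw [Real.norm_eq_abs, abs_mul, abs_mul, abs_div, abs_of_nonneg hb0, hτs,
        abs_of_pos (mul_pos hsv hsM)]
      calc |u| / (√(v N) * √(M N)) * b N * |(d : ℝ) - i|
          ≤ |u| / (√(v N) * √(M N)) * (C * √(v N)) * |(d : ℝ) - i| := by gcongr
        _ = _ := by field_simp
    have h3 : Continuous fun x : ℝ => Complex.exp ((x : ℂ) * Complex.I) := by fun_prop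
    have h4 := (h3.tendsto 0).comp h1
    simpa [Function.comp_def] using h4
  have hlim := (hpow.mul hphase).sub_const (Complex.exp (-(1 / 2 : ℂ) * (u : ℂ) ^ 2))
  rw [mul_one, sub_self] at hlim
  refine hlim.congr' ?_
  filter_upwards [(hτt.const_mul_atTop Real.pi_pos).eventually_gt_atTop |u|,
    eventually_ge_atTop i] with N hN hNi
  have hmem : u ∈ Set.Ioc (-(Real.pi * τ N)) (Real.pi * τ N) :=
    ⟨by linarith [neg_abs_le u], by linarith [le_abs_self u]⟩
  change _ = fourierError _ (τ N) (M N * b N) u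
  rw [fourierError, Set.indicator_of_mem hmem]
  congr 1
  rw [hw, mul_pow, ← Complex.exp_nat_mul, mul_right_comm, ← Complex.exp_add]
  congr 2
  simp only [hM]
  push_cast [Nat.cast_sub hNi]
  ring

lemma tendsto_integral_norm_fourierError (hκ : 0 < κ) (hc : 0 < c) {μ : ℕ → Measure ℕ}
    (h : ∀ᶠ N in atTop, IsRegular κ c C (μ N)) {i d : ℕ} (hid : i ≤ d) :
    Tendsto (fun N : ℕ => ∫ u, ‖fourierError
      (fun t => charFun ((μ N).map (Nat.cast : ℕ → ℝ)) t ^ (N - i))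
      √(variance (fun k : ℕ => (k : ℝ)) (μ N) * ((N : ℝ) - d))
      (((N : ℝ) - d) * ∫ k, (k : ℝ) ∂(μ N)) u‖) atTop (𝓝 0) := by
  rw [← integral_zero ℝ ℝ (μ := volume)]
  refine tendsto_integral_filter_of_dominated_convergence _ ?_ ?_
    (integrable_inv_add_gaussian hc) (ae_of_all _ fun u => ?_)
  · filter_upwards [h] with N hN
    have := hN.prob
    have hmeas := measurable_charFun_map_natCast (μ N)
    refine Measurable.aestronglyMeasurable (Measurable.norm (Measurable.sub ?_ (by fun_prop)))
    refine Measurable.indicator ?_ measurableSet_Ioc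
    exact Measurable.mul (by fun_prop) ((hmeas.pow_const _).comp (by fun_prop))
  · filter_upwards [h, (tendsto_natCast_sub_atTop d).eventually_ge_atTop 2, eventually_ge_atTop i]
      with N hN hN2 hNi
    refine ae_of_all _ fun u => ?_
    rw [norm_norm]
    -- Here `i ≤ d` enters: the domination needs at least `N - d` factors.
    refine hN.norm_fourierError_le hκ hc hN2 ?_ _ u
    rw [Nat.cast_sub hNi]
    have : (i : ℝ) ≤ d := by exact_mod_cast hid
    linarith
  · simpa using (tendsto_fourierError hκ h u).norm

end LocalLimit

end MoneyExchange

/-! ### From the random variables to their laws -/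

namespace MoneyExchange

/-- The characteristic function of a sum of independent identically distributed variables. -/
lemma charFun_map_sum_eq_pow {Ω ι : Type*} [MeasurableSpace Ω] {P : Measure Ω}
    [IsProbabilityMeasure P] {μ : Measure ℕ} {X : ι → Ω → ℕ} {s T : Finset ι} (hT : T ⊆ s)
    (hlaw : ∀ j ∈ s, HasLaw (X j) μ P) (hindep : iIndepFun (fun j : s => X j) P) (t : ℝ) :
    charFun ((P.map fun ω => ∑ j ∈ T, X j ω).map (Nat.cast : ℕ → ℝ)) t =
      charFun (μ.map (Nat.cast : ℕ → ℝ)) t ^ T.card := by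
  have hX : ∀ j ∈ T, AEMeasurable (X j) P := fun j hj => (hlaw j (hT hj)).aemeasurable
  have hXr : ∀ j ∈ T, AEMeasurable (fun ω => (X j ω : ℝ)) P := fun j hj =>
    (Measurable.of_discrete (f := (Nat.cast : ℕ → ℝ))).comp_aemeasurable (hX j hj)
  have hi : iIndepFun (T.restrict fun j ω => (X j ω : ℝ)) P := by
    have h1 : iIndepFun (fun j : T => X j) P :=
      hindep.precomp (g := fun j : T => (⟨j, hT j.2⟩ : s)) fun a b hab =>
        Subtype.ext (congrArg (fun x : s => (x : ι)) hab)
    exact h1.comp (fun _ => (Nat.cast : ℕ → ℝ)) fun _ => Measurable.of_discrete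
  rw [AEMeasurable.map_map_of_aemeasurable (by fun_prop)
    (Finset.aemeasurable_fun_sum T fun j hj => hX j hj)]
  have h2 : (Nat.cast : ℕ → ℝ) ∘ (fun ω => ∑ j ∈ T, X j ω) =
      fun ω => ∑ j ∈ T, (X j ω : ℝ) := by
    ext ω
    simp
  rw [h2, hi.charFun_map_fun_finsetSum_eq_prod hXr, Finset.prod_apply, ← Finset.prod_const]
  refine Finset.prod_congr rfl fun j hj => ?_
  rw [← (hlaw j (hT hj)).map_eq, AEMeasurable.map_map_of_aemeasurable (by fun_prop) (hX j hj)]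
  rfl

lemma variance_natCast_eq_of_hasLaw {Ω : Type*} [MeasurableSpace Ω] {P : Measure Ω}
    {μ : Measure ℕ} {X : Ω → ℕ} (h : HasLaw X μ P) :
    variance (fun ω => (X ω : ℝ)) P = variance (fun k : ℕ => (k : ℝ)) μ := by
  rw [← h.map_eq, variance_map (by fun_prop) h.aemeasurable]
  rfl

/-- The sites start at `1`, so an element `0` of `B` removes nothing: the number of summands may
exceed `N - |B|` by one. -/
lemma eventually_card_Icc_sdiff (B : Finset ℕ) :
    ∀ᶠ N : ℕ in atTop, (Finset.Icc 1 N \ B).card = N - (B.erase 0).card := by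
  filter_upwards [eventually_ge_atTop (B.sup id)] with N hN
  rw [Finset.card_sdiff, Nat.card_Icc, Nat.add_sub_cancel]
  congr 2
  ext k
  have : k ∈ B → k ≤ N := fun hk => (Finset.le_sup (f := id) hk).trans hN
  simp only [Finset.mem_inter, Finset.mem_Icc, Finset.mem_erase]
  constructor
  · rintro ⟨h1, h2⟩
    exact ⟨by omega, h1⟩
  · rintro ⟨h1, h2⟩
    exact ⟨h2, by omega, this h2⟩

end MoneyExchange

theorem theorem3p2
    (g : ℕ → ℝ) (hg_nonneg : ∀ k, 0 ≤ g k) (hg_zero : 0 < g 0)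
    (hg : (∃ α c : ℝ, 0 < c ∧ Tendsto (fun k : ℕ => g k / (k : ℝ) ^ α) atTop (𝓝 c)) ∨
      Summable g)
    (b : ℕ → ℝ) (hb_pos : ∀ N, 1 ≤ N → 0 < b N) (hb : Tendsto b atTop atTop)
    {Ω : ℕ → Type*} [∀ N, MeasurableSpace (Ω N)]
    (P : (N : ℕ) → Measure (Ω N)) [∀ N, IsProbabilityMeasure (P N)]
    (X : (N : ℕ) → ℕ → Ω N → ℕ)
    (hX_law : ∀ N, ∀ j ∈ Finset.Icc 1 N,
      HasLaw (X N j) (MoneyExchange.nu g (MoneyExchange.sStar g (b N))) (P N))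
    (hX_indep : ∀ N, iIndepFun (fun j : Finset.Icc 1 N => X N j) (P N))
    (σsq : ℕ → ℝ) (hσsq : ∀ N, σsq N = variance (fun ω => (X N 1 ω : ℝ)) (P N))
    (B : Finset ℕ) :
    Tendsto
      (fun N : ℕ => ⨆ L : ℕ, ENNReal.ofReal
        |√(σsq N * ((N : ℝ) - (B.card : ℝ))) *
            (P N).real {ω | ∑ j ∈ Finset.Icc 1 N \ B, X N j ω = L} -
          1 / √(2 * Real.pi) *
            Real.exp (-(((L : ℝ) - ((N : ℝ) - (B.card : ℝ)) * b N) ^ 2 /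
              (2 * σsq N * ((N : ℝ) - (B.card : ℝ)))))|)
      atTop (𝓝 0) := by
  obtain ⟨D, hD, hdbl⟩ := MoneyExchange.exists_doubling hg_nonneg hg_zero hg
  obtain ⟨κ, c, C, hκ, hc, -, hreg⟩ :=
    MoneyExchange.exists_isRegular_nu hg_nonneg hg_zero hdbl hD
  set μ : ℕ → Measure ℕ := fun N => MoneyExchange.nu g (MoneyExchange.sStar g (b N)) with hμ
  have hstar : ∀ᶠ N in atTop, MoneyExchange.IsRegular κ c C (μ N) ∧ ∫ k, (k : ℝ) ∂(μ N) = b N := by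
    filter_upwards [hb.eventually_gt_atTop (8 * D)] with N hN
    obtain ⟨h1, h2, h3⟩ := MoneyExchange.sStar_mem hg_nonneg hg_zero hdbl hD hN
    exact ⟨hreg _ h1 h2, h3⟩
  -- Applied with `i = |B \ {0}|`, the number of sites eventually removed, and `d = |B|`, the number
  -- in the normalization.
  have hlim := MoneyExchange.tendsto_integral_norm_fourierError hκ hc
    (hstar.mono fun N h => h.1) (Finset.card_le_card (Finset.erase_subset 0 B))
  have hlim' := ENNReal.tendsto_ofReal (hlim.const_mul (1 / (2 * Real.pi)))
  rw [mul_zero, ENNReal.ofReal_zero] at hlim'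
  refine tendsto_of_tendsto_of_tendsto_of_le_of_le' tendsto_const_nhds hlim'
    (Eventually.of_forall fun _ => zero_le) ?_
  filter_upwards [hstar, MoneyExchange.eventually_card_Icc_sdiff B, eventually_ge_atTop 1,
    (MoneyExchange.tendsto_natCast_sub_atTop B.card).eventually_gt_atTop 0] with N hN hcard hN1 hM
  obtain ⟨hNreg, hNmean⟩ := hN
  refine iSup_le fun L => ENNReal.ofReal_le_ofReal ?_
  have hσ : σsq N = variance (fun k : ℕ => (k : ℝ)) (μ N) := by
    rw [hσsq]
    exact MoneyExchange.variance_natCast_eq_of_hasLaw (hX_law N 1 (Finset.mem_Icc.2 ⟨le_rfl, hN1⟩))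
  have hS : AEMeasurable (fun ω => ∑ j ∈ Finset.Icc 1 N \ B, X N j ω) (P N) :=
    Finset.aemeasurable_fun_sum _ fun j hj =>
      (hX_law N j (Finset.sdiff_subset hj)).aemeasurable
  have hprob : IsProbabilityMeasure
      ((P N).map fun ω => ∑ j ∈ Finset.Icc 1 N \ B, X N j ω) := Measure.isProbabilityMeasure_map hS
  have hv : 0 < variance (fun k : ℕ => (k : ℝ)) (μ N) * ((N : ℝ) - B.card) :=
    mul_pos (hκ.trans_le hNreg.le_variance) hM
  have hmain := MoneyExchange.abs_sub_gaussian_le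
    ((P N).map fun ω => ∑ j ∈ Finset.Icc 1 N \ B, X N j ω) (Real.sqrt_pos.2 hv)
    (((N : ℝ) - B.card) * ∫ k, (k : ℝ) ∂(μ N)) L
  have hchar : charFun (((P N).map fun ω => ∑ j ∈ Finset.Icc 1 N \ B, X N j ω).map
      (Nat.cast : ℕ → ℝ)) =
      fun t => charFun ((μ N).map (Nat.cast : ℕ → ℝ)) t ^ (N - (B.erase 0).card) := by
    ext t
    rw [MoneyExchange.charFun_map_sum_eq_pow Finset.sdiff_subset (hX_law N) (hX_indep N), hcard]
  have hpre : ((P N).map fun ω => ∑ j ∈ Finset.Icc 1 N \ B, X N j ω).real {L} =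
      (P N).real {ω | ∑ j ∈ Finset.Icc 1 N \ B, X N j ω = L} := by
    rw [measureReal_def, Measure.map_apply_of_aemeasurable hS (MeasurableSet.singleton L)]
    rfl
  rw [hchar, hpre] at hmain
  refine le_trans (le_of_eq ?_) hmain
  rw [hσ, hNmean, div_pow, Real.sq_sqrt hv.le]
  congr 4
  rw [neg_div, div_div]
  congr 2
  ring
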